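/- For $m\in\mathbb{N}_0$ let $(a;q)_m=\prod_{j=0}^{m-1}(1-aq^j)$, and let $$\tilde P_n(x;\alpha,\beta,\gamma;q)=\frac{(\alpha q;q)_n(\gamma q;q)_n}{(\alpha\beta q^{n+1};q)_n}\sum_{m=0}^{n}\frac{(q^{-n};q)_m(\alpha\beta q^{n+1};q)_m(x;q)_m}{(\alpha q;q)_m(\gamma q;q)_m}\,\frac{q^m}{(q;q)_m}$$ be the (monic) big $q$-Jacobi polynomials. **Theorem.** Let $0<q<1$, let $\alpha,\beta,\gamma\in\mathbb{R}$ with $0<\alpha q<1$, $0<\beta q<1$ and $\gamma<0$, and let $n\ge 2$ be an integer. The polynomials $\tilde P_n(x;\alpha,\beta,\gamma;q)$ and $\tilde P_{n-1}(x;\alpha,\beta,\gamma;q)$ have degrees $n$ and $n-1$ and only real, simple zeros $x_{n,1}<\cdots<x_{n,n}$ and $x_{n-1,1}<\cdots<x_{n-1,n-1}$, respectively, and the following hold. (i) If $\alpha>1$, then $\tilde P_n(x;\frac{\alpha}{q},\beta,\gamma;q)$ has degree $n$ and only real, simple zeros $y_{n,1}<\cdots<y_{n,n}$, and $$\gamma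 q<x_{n,1}<y_{n,1}<x_{n-1,1}<x_{n,2}<y_{n,2}<x_{n-1,2}<\cdots<x_{n-1,n-1}<x_{n,n}<y_{n,n}.$$ (ii) If $\beta>1$, then $\tilde P_n(x;\alpha,\frac{\beta}{q},\gamma;q)$ has degree $n$ and only real, simple zeros $z_{n,1}<\cdots<z_{n,n}$, and $$z_{n,1}<\gamma q<x_{n,1}<x_{n-1,1}<z_{n,2}<x_{n,2}<\cdots<x_{n-1,n-1}<z_{n,n}<x_{n,n}<\alpha q.$$ (iii) If $\beta>1$, then $\tilde P_n(x;\alpha,\frac{\beta}{q},\frac{\gamma}{q};q)$ has degree $n$ and only real, simple zeros $w_{n,1}<\cdots<w_{n,n}$, and $$w_{n,1}<x_{n,1}<x_{n-1,1}<w_{n,2}<x_{n,2}<\cdots<x_{n-1,n-1}<w_{n,n}<x_{n,n}<\alpha q.$$ (iv) If $\alpha>1$, $\beta>1$ and $n\ge 3$, then $\tilde P_n(x;\frac{\alpha}{q},\frac{\beta}{q},\gamma;q)$ has degree $n$ and all its zeros $v_{n,1}<\cdots<v_{n,n}$ are real and distinct, and $v_{n,1}<\gamma q$. -/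

import Mathlib

open Polynomial

noncomputable section

/-- The `q`-shifted factorial `(a; q)_m = ∏_{j=0}^{m-1} (1 - a q^j)` in a commutative ring. -/
def qPochhammer {R : Type*} [CommRing R] (a q : R) (m : ℕ) : R :=
  ∏ j ∈ Finset.range m, (1 - a * q ^ j)

/-- The monic big `q`-Jacobi polynomial
`((αq;q)_n (γq;q)_n / (αβq^{n+1};q)_n) * ₃φ₂(q^{-n}, αβq^{n+1}, x; αq, γq; q, q)`
as a real polynomial in `x`. The basic hypergeometric series is written as a finite sum, since
`(q^{-n}; q)_m = 0` for `m > n`; its factor `(-1)^m q^(m choose 2)` carries the exponent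
`1 + 2 - 3 = 0`. -/
def bigQJacobi (n : ℕ) (α β γ q : ℝ) : ℝ[X] :=
  C (qPochhammer (α * q) q n * qPochhammer (γ * q) q n /
      qPochhammer (α * β * q ^ (n + 1)) q n) *
    ∑ m ∈ Finset.range (n + 1),
      C (qPochhammer ((q ^ n)⁻¹) q m * qPochhammer (α * β * q ^ (n + 1)) q m /
          (qPochhammer (α * q) q m * qPochhammer (γ * q) q m) *
          (q ^ m / qPochhammer q q m)) *
        qPochhammer X (C q) m

/-- The polynomial `p` has degree `n`, and `x 1 < x 2 < ⋯ < x n` is the increasing list of all its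
zeros; in particular its zeros are all real and simple. Only the values `x 1, …, x n` matter. -/
def IsZeroList (p : ℝ[X]) (n : ℕ) (x : ℕ → ℝ) : Prop :=
  p.natDegree = n ∧ StrictMonoOn x (Set.Icc 1 n) ∧
    ∀ t : ℝ, p.IsRoot t ↔ ∃ j ∈ Set.Icc 1 n, x j = t

end

/-! Take `s = αβ` as third parameter; the series is then symmetric in `α` and `γ`. Write P_n for the
monic polynomial. Comparing coefficients in the basis (x;q)_m yields contiguous relations: the
shifted polynomial in (i), (ii) and (iii) is P_n + a P_{n-1} with a constant a, negative in (i) and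
positive in (ii) and (iii). `monicJacobi_contiguous_left` serves (i) and, with `α` and `γ`
exchanged, (iii); `monicJacobi_contiguous_both` serves (ii).

In the monic three-term recurrence P_{n-1} is subtracted with a positive coefficient, and the ratio
of consecutive values at γq and at αq is explicit (`jacobiPhi_eval_succ`), so these values have
signs (-1)^n and +. By induction the zeros of P_n and P_{n-1} interlace inside (γq, αq). At a zero
of P_n the sum P_n + a P_{n-1} has the sign of a P_{n-1}, and at a zero of P_{n-1} that of P_n. This
traps its zeros one by one, the sign of a deciding to which side they move. In (ii) the sum at γq is
a multiple of P_{n-1}(γq), positive when β > 1; its sign (-1)^{n-1} is opposite to the sign near -∞,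
so a zero lies to the left of γq.

For (iv) the two shifts are composed: the polynomial is Z_n + a Z_{n-1}, with a < 0 and Z_k the
polynomials of (ii). At the zeros of P_{n-1} the recurrence gives it the sign of P_n, and at γq it
still has sign (-1)^{n-1}. -/

noncomputable section

/-! ### Shifted factorials. -/

section QPochhammer

variable {R : Type*} [CommRing R]

@[simp] theorem qPochhammer_zero (a q : R) : qPochhammer a q 0 = 1 := by
  simp [qPochhammer]

theorem qPochhammer_succ (a q : R) (m : ℕ) :
    qPochhammer a q (m + 1) = qPochhammer a q m * (1 - a * q ^ m) := by
  simp [qPochhammer, Finset.prod_range_succ]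

theorem qPochhammer_succ' (a q : R) (m : ℕ) :
    qPochhammer a q (m + 1) = (1 - a) * qPochhammer (a * q) q m := by
  rw [qPochhammer, Finset.prod_range_succ', mul_comm, qPochhammer]
  simp [pow_succ', mul_assoc]

theorem qPochhammer_shift (a q : R) (m : ℕ) :
    (1 - a) * qPochhammer (a * q) q m = qPochhammer a q m * (1 - a * q ^ m) := by
  rw [← qPochhammer_succ, qPochhammer_succ']

end QPochhammer

theorem qPochhammer_ne_zero {a q : ℝ} (h : ∀ j, a * q ^ j ≠ 1) (m : ℕ) :
    qPochhammer a q m ≠ 0 :=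
  Finset.prod_ne_zero_iff.2 fun j _ => sub_ne_zero.2 (h j).symm

theorem qPochhammer_pos {a q : ℝ} (h : ∀ j, a * q ^ j < 1) (m : ℕ) :
    0 < qPochhammer a q m :=
  Finset.prod_pos fun j _ => sub_pos.2 (h j)

theorem qPochhammer_mul_shift {a q : ℝ} (h : a ≠ 1) (m : ℕ) :
    qPochhammer (a * q) q m = qPochhammer a q m * (1 - a * q ^ m) / (1 - a) := by
  rw [eq_div_iff (sub_ne_zero.2 h.symm), mul_comm, qPochhammer_shift]

theorem qPochhammer_inv_pow_eq_zero {q : ℝ} (hq : q ≠ 0) {n m : ℕ} (h : n < m) :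
    qPochhammer ((q ^ n)⁻¹) q m = 0 :=
  Finset.prod_eq_zero (Finset.mem_range.2 h) (by field_simp; simp)

theorem mul_qPochhammer_X (q : ℝ) (hq : q ≠ 0) (m : ℕ) :
    (X - 1) * qPochhammer (X : ℝ[X]) (C q) m =
      C ((q ^ m)⁻¹ - 1) * qPochhammer X (C q) m -
        C ((q ^ m)⁻¹) * qPochhammer X (C q) (m + 1) := by
  have h : (C ((q ^ m)⁻¹) : ℝ[X]) * C q ^ m = 1 := by
    rw [← C_pow, ← C_mul, inv_mul_cancel₀ (pow_ne_zero _ hq), C_1]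
  rw [qPochhammer_succ, C_sub, C_1]
  linear_combination -X * qPochhammer (X : ℝ[X]) (C q) m * h

/-- The coefficient of `(x; q)_m` in the big `q`-Jacobi polynomial normalized to be `1` at `x = 1`,
in terms of `α`, `γ` and `s = αβ`. -/
def jacobiCoeff (n m : ℕ) (α γ s q : ℝ) : ℝ :=
  qPochhammer ((q ^ n)⁻¹) q m * qPochhammer (s * q ^ (n + 1)) q m /
    (qPochhammer (α * q) q m * qPochhammer (γ * q) q m) * (q ^ m / qPochhammer q q m)

/-- The value at `x = 1` of the monic big `q`-Jacobi polynomial. -/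
def jacobiScale (n : ℕ) (α γ s q : ℝ) : ℝ :=
  qPochhammer (α * q) q n * qPochhammer (γ * q) q n / qPochhammer (s * q ^ (n + 1)) q n

/-- The big `q`-Jacobi polynomial normalized to be `1` at `x = 1`. -/
def jacobiPhi (n : ℕ) (α γ s q : ℝ) : ℝ[X] :=
  ∑ m ∈ Finset.range (n + 1), C (jacobiCoeff n m α γ s q) * qPochhammer X (C q) m

/-- The monic big `q`-Jacobi polynomial in terms of `α`, `γ` and `s = αβ`. -/
def monicJacobi (n : ℕ) (α γ s q : ℝ) : ℝ[X] :=
  C (jacobiScale n α γ s q) * jacobiPhi n α γ s q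

theorem bigQJacobi_eq_monicJacobi (n : ℕ) (α β γ q : ℝ) :
    bigQJacobi n α β γ q = monicJacobi n α γ (α * β) q := rfl

theorem jacobiCoeff_swap (n m : ℕ) (α γ s q : ℝ) :
    jacobiCoeff n m α γ s q = jacobiCoeff n m γ α s q := by
  simp only [jacobiCoeff, mul_comm (qPochhammer (α * q) q m)]

theorem jacobiPhi_swap (n : ℕ) (α γ s q : ℝ) : jacobiPhi n α γ s q = jacobiPhi n γ α s q := by
  simp only [jacobiPhi, jacobiCoeff_swap _ _ α]

theorem monicJacobi_swap (n : ℕ) (α γ s q : ℝ) :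
    monicJacobi n α γ s q = monicJacobi n γ α s q := by
  simp only [monicJacobi, jacobiScale, jacobiPhi_swap _ α, mul_comm (qPochhammer (α * q) q n)]

theorem jacobiCoeff_eq_zero {q : ℝ} (hq : q ≠ 0) {n m : ℕ} (h : n < m) (α γ s : ℝ) :
    jacobiCoeff n m α γ s q = 0 := by
  simp [jacobiCoeff, qPochhammer_inv_pow_eq_zero hq h]

theorem jacobiPhi_eq_sum {q : ℝ} (hq : q ≠ 0) {n N : ℕ} (h : n < N) (α γ s : ℝ) :
    jacobiPhi n α γ s q =
      ∑ m ∈ Finset.range N, C (jacobiCoeff n m α γ s q) * qPochhammer X (C q) m := by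
  refine Finset.sum_subset (by simpa using h) fun m _ hm => ?_
  rw [jacobiCoeff_eq_zero hq (by simpa using hm)]
  simp

theorem pow_succ_ne_one {q : ℝ} (hq0 : 0 < q) (hq1 : q < 1) (j : ℕ) : q ^ (j + 1) ≠ 1 :=
  (pow_lt_one₀ hq0.le hq1 j.succ_ne_zero).ne

/-- The factor `q ^ (n + 1) - q ^ m` vanishes at `m = n + 1`, so series of consecutive degrees can
be compared termwise without treating the top term apart. -/
theorem qPochhammer_inv_pow_pred {q : ℝ} (hq0 : 0 < q) (hq1 : q < 1) (n m : ℕ) :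
    qPochhammer ((q ^ n)⁻¹) q m =
      qPochhammer ((q ^ (n + 1))⁻¹) q m * (q ^ (n + 1) - q ^ m) / (q ^ (n + 1) - 1) := by
  have h := pow_succ_ne_one hq0 hq1 n
  have h1 : (q ^ n)⁻¹ = (q ^ (n + 1))⁻¹ * q := by rw [pow_succ]; field_simp
  have h2 := sub_ne_zero.2 h
  have h3 := sub_ne_zero.2 (inv_ne_one.2 h).symm
  have h4 : q ^ (n + 1) ≠ 0 := pow_ne_zero _ hq0.ne'
  rw [h1, qPochhammer_mul_shift (inv_ne_one.2 h), div_eq_div_iff h3 h2]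
  field_simp

/-! ### Contiguous relations. -/

/-- Passing from `(α, s)` to `(αq, sq)` keeps `β = s / α`, so this is the shift of `α` alone. It is
an identity between coefficients of each (x;q)_m. -/
theorem monicJacobi_contiguous_left {q : ℝ} (hq0 : 0 < q) (hq1 : q < 1) (n : ℕ) (α γ s : ℝ)
    (hα : ∀ j, α * q ^ (j + 1) ≠ 1) (hγ : ∀ j, γ * q ^ (j + 1) ≠ 1)
    (hs : ∀ j, s * q ^ (n + 2 + j) ≠ 1) :
    monicJacobi (n + 1) α γ s q = monicJacobi (n + 1) (α * q) γ (s * q) q +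
      C (-(q * (1 - q ^ (n + 1)) * (α - s * q ^ (n + 1)) * (1 - γ * q ^ (n + 1))) /
        ((1 - s * q ^ (2 * n + 2)) * (1 - s * q ^ (2 * n + 3)))) *
        monicJacobi n (α * q) γ (s * q) q := by
  have hq := hq0.ne'
  simp only [monicJacobi]
  -- The series of degree `n` is padded with a zero term so that all three sums have the same range.
  rw [jacobiPhi_eq_sum hq (n.lt_add_one.trans (n + 1).lt_add_one), jacobiPhi, jacobiPhi]
  simp only [Finset.mul_sum, ← Finset.sum_add_distrib, ← mul_assoc, ← C_mul, ← add_mul, ← C_add]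
  refine Finset.sum_congr rfl fun m hm => ?_
  clear hm
  congr 2
  have e1 : α * q * q ^ n = α * q ^ (n + 1) := by ring
  have g1 : γ * q * q ^ n = γ * q ^ (n + 1) := by ring
  have a1 : qPochhammer (α * q * q) q n = qPochhammer (α * q) q n * (1 - α * q * q ^ n) /
    (1 - α * q) := qPochhammer_mul_shift (by simpa using hα 0) n
  have a2 : qPochhammer (α * q * q) q m = qPochhammer (α * q) q m * (1 - α * q * q ^ m) /
    (1 - α * q) := qPochhammer_mul_shift (by simpa using hα 0) m
  have s0 : s * q * q ^ (n + 1) = s * q ^ (n + 2) := by ring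
  have s0' : s * q * q ^ (n + 1 + 1) = s * q ^ (n + 2) * q := by ring
  have s1 : ∀ m, qPochhammer (s * q ^ (n + 2) * q) q m =
      qPochhammer (s * q ^ (n + 2)) q m * (1 - s * q ^ (n + 2) * q ^ m) /
    (1 - s * q ^ (n + 2)) := qPochhammer_mul_shift (by simpa using hs 0)
  have w1 := qPochhammer_ne_zero (a := α * q) (q := q)
    (fun j => by have := hα j; rwa [pow_succ', ← mul_assoc] at this)
  have w2 := qPochhammer_ne_zero (a := γ * q) (q := q)
    (fun j => by have := hγ j; rwa [pow_succ', ← mul_assoc] at this)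
  have w3 := qPochhammer_ne_zero (a := s * q ^ (n + 2)) (q := q)
    (fun j => by have := hs j; rwa [pow_add, ← mul_assoc] at this)
  have z0 := sub_ne_zero.2 (hα 0).symm
  have z1 := sub_ne_zero.2 (hα m).symm
  have z2 := sub_ne_zero.2 (hα n).symm
  have z3 := sub_ne_zero.2 (hs 0).symm
  have z4 := sub_ne_zero.2 (hs m).symm
  have z5 := sub_ne_zero.2 (hs n).symm
  have z6 := sub_ne_zero.2 (hs (n + 1)).symm
  have z7 := sub_ne_zero.2 (pow_succ_ne_one hq0 hq1 n)
  simp only [jacobiScale, jacobiCoeff]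
  rw [s0, s0', s1, s1, a2, qPochhammer_succ (α * q * q), a1, qPochhammer_succ (α * q),
    qPochhammer_succ (γ * q), qPochhammer_succ (s * q ^ (n + 2)),
    qPochhammer_inv_pow_pred hq0 hq1 n]
  have v1 := w1 n
  have v2 := w1 m
  have v3 := w2 n
  have v4 := w2 m
  have v5 := w3 n
  have v6 := w3 m
  -- All factorials now have common bases; once they and the powers of `q` are treated as unknowns,
  -- a rational identity remains.
  generalize qPochhammer (α * q) q n = A1 at *
  generalize qPochhammer (α * q) q m = A2 at *
  generalize qPochhammer (γ * q) q n = G1 at *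
  generalize qPochhammer (γ * q) q m = G2 at *
  generalize qPochhammer (s * q ^ (n + 2)) q n = S1 at *
  generalize qPochhammer (s * q ^ (n + 2)) q m = S2 at *
  generalize q ^ m / qPochhammer q q m = Z at *
  generalize qPochhammer ((q ^ (n + 1))⁻¹) q m = I at *
  have hN : q ^ n ≠ 0 := pow_ne_zero _ hq
  simp only [pow_add, two_mul, pow_one, pow_zero, mul_one, one_mul] at *
  generalize q ^ n = N at *
  generalize q ^ m = M at *
  clear hα hγ hs s0 s0' s1 a1 a2 e1 g1 w1 w2 w3
  field_simp at z0 z1 z2 z3 z4 z5 z6 z7 ⊢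
  ring

/-- With `α` and `γ` fixed, multiplying `s` by `q` is the shift of `β` alone. -/
theorem monicJacobi_contiguous_both {q : ℝ} (hq0 : 0 < q) (hq1 : q < 1) (n : ℕ) (α γ s : ℝ)
    (hα : ∀ j, α * q ^ (j + 1) ≠ 1) (hγ : ∀ j, γ * q ^ (j + 1) ≠ 1)
    (hs : ∀ j, s * q ^ (n + 2 + j) ≠ 1) :
    monicJacobi (n + 1) α γ s q = monicJacobi (n + 1) α γ (s * q) q +
      C (s * q * q ^ (n + 1) * (1 - q ^ (n + 1)) * (1 - α * q ^ (n + 1)) * (1 - γ * q ^ (n + 1)) /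
        ((1 - s * q ^ (2 * n + 2)) * (1 - s * q ^ (2 * n + 3)))) *
        monicJacobi n α γ (s * q) q := by
  have hq := hq0.ne'
  simp only [monicJacobi]
  rw [jacobiPhi_eq_sum hq (n.lt_add_one.trans (n + 1).lt_add_one), jacobiPhi, jacobiPhi]
  simp only [Finset.mul_sum, ← Finset.sum_add_distrib, ← mul_assoc, ← C_mul, ← add_mul, ← C_add]
  refine Finset.sum_congr rfl fun m hm => ?_
  clear hm
  congr 2
  have s0 : s * q * q ^ (n + 1) = s * q ^ (n + 2) := by ring
  have s0' : s * q * q ^ (n + 1 + 1) = s * q ^ (n + 2) * q := by ring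
  have s1 : ∀ m, qPochhammer (s * q ^ (n + 2) * q) q m =
      qPochhammer (s * q ^ (n + 2)) q m * (1 - s * q ^ (n + 2) * q ^ m) /
    (1 - s * q ^ (n + 2)) := qPochhammer_mul_shift (by simpa using hs 0)
  have w1 := qPochhammer_ne_zero (a := α * q) (q := q)
    (fun j => by have := hα j; rwa [pow_succ', ← mul_assoc] at this)
  have w2 := qPochhammer_ne_zero (a := γ * q) (q := q)
    (fun j => by have := hγ j; rwa [pow_succ', ← mul_assoc] at this)
  have w3 := qPochhammer_ne_zero (a := s * q ^ (n + 2)) (q := q)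
    (fun j => by have := hs j; rwa [pow_add, ← mul_assoc] at this)
  have z1 := sub_ne_zero.2 (hα m).symm
  have z2 := sub_ne_zero.2 (hα n).symm
  have z3 := sub_ne_zero.2 (hs 0).symm
  have z4 := sub_ne_zero.2 (hs m).symm
  have z5 := sub_ne_zero.2 (hs n).symm
  have z6 := sub_ne_zero.2 (hs (n + 1)).symm
  have z7 := sub_ne_zero.2 (pow_succ_ne_one hq0 hq1 n)
  simp only [jacobiScale, jacobiCoeff]
  rw [s0, s0', s1, s1, qPochhammer_succ (α * q),
    qPochhammer_succ (γ * q), qPochhammer_succ (s * q ^ (n + 2)),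
    qPochhammer_inv_pow_pred hq0 hq1 n]
  have v1 := w1 n
  have v2 := w1 m
  have v3 := w2 n
  have v4 := w2 m
  have v5 := w3 n
  have v6 := w3 m
  generalize qPochhammer (α * q) q n = A1 at *
  generalize qPochhammer (α * q) q m = A2 at *
  generalize qPochhammer (γ * q) q n = G1 at *
  generalize qPochhammer (γ * q) q m = G2 at *
  generalize qPochhammer (s * q ^ (n + 2)) q n = S1 at *
  generalize qPochhammer (s * q ^ (n + 2)) q m = S2 at *
  generalize q ^ m / qPochhammer q q m = Z at *
  generalize qPochhammer ((q ^ (n + 1))⁻¹) q m = I at *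
  have hN : q ^ n ≠ 0 := pow_ne_zero _ hq
  simp only [pow_add, two_mul, pow_one, pow_zero, mul_one] at *
  generalize q ^ n = N at *
  generalize q ^ m = M at *
  clear hα hγ hs s0 s0' s1 w1 w2 w3
  field_simp at z1 z2 z3 z4 z5 z6 z7 ⊢
  ring

/-! ### Three-term recurrence and values at the endpoints. -/

/-- The coefficient of `P_{n+1}` in the three-term recurrence of the normalized polynomials. -/
def recurrenceUp (n : ℕ) (α γ s q : ℝ) : ℝ :=
  (1 - α * q ^ (n + 1)) * (1 - s * q ^ (n + 1)) * (1 - γ * q ^ (n + 1)) /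
    ((1 - s * q ^ (2 * n + 1)) * (1 - s * q ^ (2 * n + 2)))

/-- The coefficient of `P_{n-1}` in the three-term recurrence of the normalized polynomials. -/
def recurrenceDown (n : ℕ) (α γ s q : ℝ) : ℝ :=
  -(q ^ (n + 1) * (1 - q ^ n) * (γ - s * q ^ n) * (α - s * q ^ n)) /
    ((1 - s * q ^ (2 * n)) * (1 - s * q ^ (2 * n + 1)))

theorem jacobiCoeff_zero_right (n : ℕ) (α γ s q : ℝ) : jacobiCoeff n 0 α γ s q = 1 := by
  simp [jacobiCoeff]

/-- This is the coefficient of (x;q)_{m+1} in the recurrence; the left side comes from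
`mul_qPochhammer_X`, by which multiplication by `X - 1` is bidiagonal in this basis. -/
theorem jacobiCoeff_recurrence {q : ℝ} (hq0 : 0 < q) (hq1 : q < 1) (n m : ℕ) (α γ s : ℝ)
    (hα : ∀ j, α * q ^ (j + 1) ≠ 1) (hγ : ∀ j, γ * q ^ (j + 1) ≠ 1)
    (hs : ∀ j, s * q ^ (j + 2) ≠ 1) :
    jacobiCoeff (n + 1) (m + 1) α γ s q * ((q ^ (m + 1))⁻¹ - 1) -
        jacobiCoeff (n + 1) m α γ s q * (q ^ m)⁻¹ =
      recurrenceUp (n + 1) α γ s q * jacobiCoeff (n + 2) (m + 1) α γ s q -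
        (recurrenceUp (n + 1) α γ s q + recurrenceDown (n + 1) α γ s q) *
          jacobiCoeff (n + 1) (m + 1) α γ s q +
        recurrenceDown (n + 1) α γ s q * jacobiCoeff n (m + 1) α γ s q := by
  have hq := hq0.ne'
  have i0 : qPochhammer ((q ^ (n + 2))⁻¹) q (m + 1) =
      (1 - (q ^ (n + 2))⁻¹) * qPochhammer ((q ^ (n + 1))⁻¹) q m := by
    rw [qPochhammer_succ']
    congr 2
    rw [pow_succ _ (n + 1)]
    field_simp
  have s0 : s * q ^ (n + 2 + 1) = s * q ^ (n + 2) * q := by ring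
  have s1 : qPochhammer (s * q ^ (n + 2) * q) q (m + 1) =
      qPochhammer (s * q ^ (n + 2)) q (m + 1) * (1 - s * q ^ (n + 2) * q ^ (m + 1)) /
    (1 - s * q ^ (n + 2)) := qPochhammer_mul_shift (hs n) _
  have s2 : qPochhammer (s * q ^ (n + 1)) q (m + 1) =
      (1 - s * q ^ (n + 1)) * qPochhammer (s * q ^ (n + 2)) q m := by
    rw [qPochhammer_succ', mul_assoc s, ← pow_succ]
  have v1 := qPochhammer_ne_zero (a := α * q) (q := q)
    (fun j => by have := hα j; rwa [pow_succ', ← mul_assoc] at this) m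
  have v2 := qPochhammer_ne_zero (a := γ * q) (q := q)
    (fun j => by have := hγ j; rwa [pow_succ', ← mul_assoc] at this) m
  have v3 := qPochhammer_ne_zero (a := q) (q := q)
    (fun j => by have := pow_succ_ne_one hq0 hq1 j; rwa [pow_succ'] at this) m
  have z1 := sub_ne_zero.2 (hα m).symm
  have z2 := sub_ne_zero.2 (hγ m).symm
  have z3 := sub_ne_zero.2 (hs n).symm
  have z4 := sub_ne_zero.2 (pow_succ_ne_one hq0 hq1 m).symm
  have z5 := sub_ne_zero.2 (hs (2 * n)).symm
  have z6 := sub_ne_zero.2 (hs (2 * n + 1)).symm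
  have z8 := sub_ne_zero.2 (hs (2 * n + 2)).symm
  have z7 := sub_ne_zero.2 (pow_succ_ne_one hq0 hq1 n)
  simp only [jacobiCoeff, recurrenceUp, recurrenceDown]
  rw [i0, qPochhammer_inv_pow_pred hq0 hq1 n, s0, s1, s2, qPochhammer_succ (α * q),
    qPochhammer_succ (γ * q), qPochhammer_succ (s * q ^ (n + 2)), qPochhammer_succ q,
    qPochhammer_succ ((q ^ (n + 1))⁻¹)]
  generalize qPochhammer (α * q) q m = A2 at *
  generalize qPochhammer (γ * q) q m = G2 at *
  generalize qPochhammer (s * q ^ (n + 2)) q m = S2 at *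
  generalize qPochhammer q q m = Z at *
  generalize qPochhammer ((q ^ (n + 1))⁻¹) q m = I at *
  have hN : q ^ n ≠ 0 := pow_ne_zero _ hq
  have hM : q ^ m ≠ 0 := pow_ne_zero _ hq
  simp only [mul_add, pow_add, two_mul, pow_one, mul_one] at *
  generalize q ^ n = N at *
  generalize q ^ m = M at *
  clear hα hγ hs s0 s1 s2 i0
  field_simp at z1 z2 z3 z4 z5 z6 z7 z8 ⊢
  ring

theorem jacobiPhi_recurrence {q : ℝ} (hq0 : 0 < q) (hq1 : q < 1) (n : ℕ) (α γ s : ℝ)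
    (hα : ∀ j, α * q ^ (j + 1) ≠ 1) (hγ : ∀ j, γ * q ^ (j + 1) ≠ 1)
    (hs : ∀ j, s * q ^ (j + 2) ≠ 1) :
    (X - 1) * jacobiPhi (n + 1) α γ s q =
      C (recurrenceUp (n + 1) α γ s q) * jacobiPhi (n + 2) α γ s q -
        C (recurrenceUp (n + 1) α γ s q + recurrenceDown (n + 1) α γ s q) *
          jacobiPhi (n + 1) α γ s q +
        C (recurrenceDown (n + 1) α γ s q) * jacobiPhi n α γ s q := by
  have hq := hq0.ne'
  have hL : (X - 1) * jacobiPhi (n + 1) α γ s q = ∑ m ∈ Finset.range (n + 2),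
      (C (jacobiCoeff (n + 1) (m + 1) α γ s q * ((q ^ (m + 1))⁻¹ - 1) -
        jacobiCoeff (n + 1) m α γ s q * (q ^ m)⁻¹)) * qPochhammer X (C q) (m + 1) := by
    have h1 : (X - 1) * jacobiPhi (n + 1) α γ s q =
        ∑ m ∈ Finset.range (n + 2), C (jacobiCoeff (n + 1) m α γ s q * ((q ^ m)⁻¹ - 1)) *
            qPochhammer X (C q) m -
          ∑ m ∈ Finset.range (n + 2), C (jacobiCoeff (n + 1) m α γ s q * (q ^ m)⁻¹) *
            qPochhammer X (C q) (m + 1) := by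
      rw [jacobiPhi, Finset.mul_sum, ← Finset.sum_sub_distrib]
      refine Finset.sum_congr rfl fun m _ => ?_
      rw [mul_left_comm, mul_qPochhammer_X q hq, C_mul, C_mul]
      ring
    -- Shifting the index loses nothing: the term `m = 0` has the factor `1 - 1`, and the
    -- coefficient at `m = n + 2` is zero.
    have h2 : ∑ m ∈ Finset.range (n + 2), C (jacobiCoeff (n + 1) m α γ s q * ((q ^ m)⁻¹ - 1)) *
            qPochhammer (X : ℝ[X]) (C q) m =
        ∑ m ∈ Finset.range (n + 2), C (jacobiCoeff (n + 1) (m + 1) α γ s q *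
          ((q ^ (m + 1))⁻¹ - 1)) * qPochhammer (X : ℝ[X]) (C q) (m + 1) := by
      have h3 := Finset.sum_range_succ (fun m => C (jacobiCoeff (n + 1) m α γ s q *
        ((q ^ m)⁻¹ - 1)) * qPochhammer (X : ℝ[X]) (C q) m) (n + 2)
      rw [Finset.sum_range_succ', jacobiCoeff_eq_zero hq (n + 1).lt_add_one] at h3
      simpa using h3.symm
    rw [h1, h2, ← Finset.sum_sub_distrib]
    exact Finset.sum_congr rfl fun m _ => by rw [C_sub, sub_mul]
  have hR : ∀ k ≤ n + 2, jacobiPhi k α γ s q = (∑ m ∈ Finset.range (n + 2),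
      C (jacobiCoeff k (m + 1) α γ s q) * qPochhammer X (C q) (m + 1)) + 1 := fun k hk => by
    rw [jacobiPhi_eq_sum hq (Nat.lt_succ_of_le hk), Finset.sum_range_succ']
    simp [jacobiCoeff_zero_right]
  rw [hL, hR n (by lia), hR (n + 1) (by lia), hR (n + 2) le_rfl]
  simp only [jacobiCoeff_recurrence hq0 hq1 n _ α γ s hα hγ hs, C_sub, C_add, C_mul, mul_add,
    add_mul, sub_mul, Finset.mul_sum, Finset.sum_add_distrib, Finset.sum_sub_distrib, mul_assoc]
  ring

theorem jacobiScale_ne_zero {q : ℝ} {n : ℕ} {α γ s : ℝ}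
    (hα : ∀ j, α * q ^ (j + 1) ≠ 1) (hγ : ∀ j, γ * q ^ (j + 1) ≠ 1)
    (hs : ∀ j, s * q ^ (n + 1 + j) ≠ 1) : jacobiScale n α γ s q ≠ 0 :=
  div_ne_zero (mul_ne_zero
    (qPochhammer_ne_zero (fun j => by have := hα j; rwa [pow_succ', ← mul_assoc] at this) _)
    (qPochhammer_ne_zero (fun j => by have := hγ j; rwa [pow_succ', ← mul_assoc] at this) _))
    (qPochhammer_ne_zero (fun j => by have := hs j; rwa [pow_add, ← mul_assoc] at this) _)

theorem jacobiScale_pos {q : ℝ} {n : ℕ} {α γ s : ℝ}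
    (hα : ∀ j, α * q ^ (j + 1) < 1) (hγ : ∀ j, γ * q ^ (j + 1) < 1)
    (hs : ∀ j, s * q ^ (n + 1 + j) < 1) : 0 < jacobiScale n α γ s q :=
  div_pos (mul_pos
    (qPochhammer_pos (fun j => by have := hα j; rwa [pow_succ', ← mul_assoc] at this) _)
    (qPochhammer_pos (fun j => by have := hγ j; rwa [pow_succ', ← mul_assoc] at this) _))
    (qPochhammer_pos (fun j => by have := hs j; rwa [pow_add, ← mul_assoc] at this) _)

/-- This ratio makes the leading coefficient of the recurrence equal to 1 after monic normalization.
-/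
theorem jacobiScale_succ {q : ℝ} (n : ℕ) (α γ s : ℝ)
    (hs : ∀ j, s * q ^ (n + 1 + j) ≠ 1) :
    jacobiScale (n + 1) α γ s q = recurrenceUp n α γ s q * jacobiScale n α γ s q := by
  have s0 : s * q ^ (n + 1 + 1) = s * q ^ (n + 1) * q := by ring
  have s1 : qPochhammer (s * q ^ (n + 1) * q) q (n + 1) =
      qPochhammer (s * q ^ (n + 1)) q (n + 1) * (1 - s * q ^ (n + 1) * q ^ (n + 1)) /
    (1 - s * q ^ (n + 1)) := qPochhammer_mul_shift (hs 0) _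
  have v := qPochhammer_ne_zero (a := s * q ^ (n + 1)) (q := q)
    (fun j => by have := hs j; rwa [pow_add, ← mul_assoc] at this) n
  have z1 := sub_ne_zero.2 (hs 0).symm
  have z2 := sub_ne_zero.2 (hs n).symm
  have z3 := sub_ne_zero.2 (hs (n + 1)).symm
  simp only [jacobiScale, recurrenceUp]
  rw [s0, s1, qPochhammer_succ (α * q), qPochhammer_succ (γ * q),
    qPochhammer_succ (s * q ^ (n + 1))]
  generalize qPochhammer (s * q ^ (n + 1)) q n = S at *
  simp only [pow_add, two_mul, pow_one, pow_zero, mul_one] at *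
  generalize q ^ n = N at *
  clear hs s0 s1
  field_simp at z1 z2 z3 ⊢

theorem monicJacobi_recurrence {q : ℝ} (hq0 : 0 < q) (hq1 : q < 1) (n : ℕ) (α γ s : ℝ)
    (hα : ∀ j, α * q ^ (j + 1) ≠ 1) (hγ : ∀ j, γ * q ^ (j + 1) ≠ 1)
    (hs : ∀ j, s * q ^ (j + 2) ≠ 1) :
    monicJacobi (n + 2) α γ s q =
      (X - C (1 - (recurrenceUp (n + 1) α γ s q + recurrenceDown (n + 1) α γ s q))) *
          monicJacobi (n + 1) α γ s q -
        C (recurrenceDown (n + 1) α γ s q * jacobiScale (n + 1) α γ s q /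
          jacobiScale n α γ s q) * monicJacobi n α γ s q := by
  have h := jacobiPhi_recurrence hq0 hq1 n α γ s hα hγ hs
  have hk : recurrenceDown (n + 1) α γ s q * jacobiScale (n + 1) α γ s q / jacobiScale n α γ s q *
      jacobiScale n α γ s q = recurrenceDown (n + 1) α γ s q * jacobiScale (n + 1) α γ s q := by
    -- For `n = 0` the scale is an empty product; `s * q = 1` is not excluded by `hs`, so the
    -- general nonvanishing lemma does not apply.
    rcases n with _ | n
    · simp [jacobiScale]
    · exact div_mul_cancel₀ _ (jacobiScale_ne_zero hα hγ
        (fun j => by have := hs (n + j); rwa [show n + j + 2 = n + 1 + 1 + j by ring] at this))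
  have hk' := congrArg C hk
  simp only [monicJacobi]
  rw [jacobiScale_succ (n + 1) α γ s
    (fun j => by have := hs (n + j); rwa [show n + j + 2 = n + 1 + 1 + j by ring] at this)]
  simp only [C_mul, C_sub, C_add, C_1] at *
  linear_combination (-C (jacobiScale (n + 1) α γ s q)) * h + jacobiPhi n α γ s q * hk'

theorem monicJacobi_zero (α γ s q : ℝ) : monicJacobi 0 α γ s q = 1 := by
  simp [monicJacobi, jacobiScale, jacobiPhi, jacobiCoeff]

theorem jacobiPhi_zero (α γ s q : ℝ) : jacobiPhi 0 α γ s q = 1 := by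
  simp [jacobiPhi, jacobiCoeff]

theorem jacobiScale_one (α γ s q : ℝ) :
    jacobiScale 1 α γ s q = (1 - α * q) * (1 - γ * q) / (1 - s * q ^ 2) := by
  simp [jacobiScale, qPochhammer]

theorem jacobiPhi_one {q : ℝ} (hq0 : 0 < q) (hq1 : q < 1) (α γ s : ℝ) :
    jacobiPhi 1 α γ s q = C ((1 - s * q ^ 2) / ((1 - α * q) * (1 - γ * q))) * (X - 1) + 1 := by
  have h : jacobiCoeff 1 1 α γ s q = -((1 - s * q ^ 2) / ((1 - α * q) * (1 - γ * q))) := by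
    have h1 : (1 - q) ≠ 0 := by linarith
    have h2 : (1 - q⁻¹) * (q / (1 - q)) = -1 := by field_simp; ring
    simp only [jacobiCoeff, qPochhammer, Finset.prod_range_one, pow_zero, mul_one, pow_one]
    linear_combination ((1 - s * q ^ 2) / ((1 - α * q) * (1 - γ * q))) * h2
  simp only [jacobiPhi, Finset.sum_range_succ, Finset.sum_range_zero, h, jacobiCoeff_zero_right]
  simp [qPochhammer]
  ring

theorem monicJacobi_one {q : ℝ} (hq0 : 0 < q) (hq1 : q < 1) (α γ s : ℝ)
    (hα : α * q ≠ 1) (hγ : γ * q ≠ 1) (hs : s * q ^ 2 ≠ 1) :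
    monicJacobi 1 α γ s q = X - C (1 - jacobiScale 1 α γ s q) := by
  have h : jacobiScale 1 α γ s q * ((1 - s * q ^ 2) / ((1 - α * q) * (1 - γ * q))) = 1 := by
    rw [jacobiScale_one]
    have h1 := sub_ne_zero.2 hα.symm
    have h2 := sub_ne_zero.2 hγ.symm
    have h3 := sub_ne_zero.2 hs.symm
    field_simp at h1 h2 h3 ⊢
  have h' := congrArg C h
  rw [monicJacobi, jacobiPhi_one hq0 hq1]
  simp only [C_mul, C_sub, C_1] at *
  linear_combination (X - 1) * h'

/-- At x = γq the factors (γq;q)_m cancel and a ₂φ₁ remains, which q-Chu–Vandermonde sums to a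
product; this is the ratio of consecutive products. The three-term recurrence gives it by induction.
-/
theorem jacobiPhi_eval_succ {q : ℝ} (hq0 : 0 < q) (hq1 : q < 1) (α γ s : ℝ)
    (hα : ∀ j, α * q ^ (j + 1) ≠ 1) (hγ : ∀ j, γ * q ^ (j + 1) ≠ 1)
    (hs : ∀ j, s * q ^ (j + 2) ≠ 1) (n : ℕ) :
    (1 - α * q ^ (n + 1)) * (jacobiPhi (n + 1) α γ s q).eval (γ * q) =
      -(q ^ (n + 1) * (α - s * q ^ (n + 1))) * (jacobiPhi n α γ s q).eval (γ * q) := by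
  induction n with
  | zero =>
    have h1 : (1 - α * q) ≠ 0 := sub_ne_zero.2 (by simpa using (hα 0).symm)
    have h2 : (1 - γ * q) ≠ 0 := sub_ne_zero.2 (by simpa using (hγ 0).symm)
    rw [jacobiPhi_one hq0 hq1, jacobiPhi_zero]
    simp only [eval_add, eval_mul, eval_C, eval_sub, eval_X, eval_one, zero_add, pow_one]
    field_simp at h1 h2 ⊢
    ring
  | succ n ih =>
    have h := congrArg (eval (γ * q)) (jacobiPhi_recurrence hq0 hq1 n α γ s hα hγ hs)
    simp only [eval_mul, eval_add, eval_sub, eval_X, eval_one, eval_C] at h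
    have z0 := sub_ne_zero.2 (hα n).symm
    have z1 := sub_ne_zero.2 (hα (n + 1)).symm
    have z2 := sub_ne_zero.2 (hγ (n + 1)).symm
    have z3 := sub_ne_zero.2 (hs n).symm
    have z5 := sub_ne_zero.2 (hs (2 * n)).symm
    have z6 := sub_ne_zero.2 (hs (2 * n + 1)).symm
    have z8 := sub_ne_zero.2 (hs (2 * n + 2)).symm
    generalize eval (γ * q) (jacobiPhi n α γ s q) = v0 at *
    generalize eval (γ * q) (jacobiPhi (n + 1) α γ s q) = v1 at *
    -- `recurrenceDown` contains the factor `α - s * q ^ (n + 1)` of the induction hypothesis, so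
    -- the older value is eliminated without dividing by it.
    have hd : recurrenceDown (n + 1) α γ s q * v0 =
        q * (1 - q ^ (n + 1)) * (γ - s * q ^ (n + 1)) /
          ((1 - s * q ^ (2 * n + 2)) * (1 - s * q ^ (2 * n + 3))) *
          ((1 - α * q ^ (n + 1)) * v1) := by
      rw [ih, recurrenceDown]
      ring
    rw [hd, recurrenceUp, recurrenceDown] at h
    rw [show n + 1 + 1 = n + 2 from rfl]
    generalize eval (γ * q) (jacobiPhi (n + 2) α γ s q) = v2 at *
    clear hd ih hα hγ hs
    simp only [mul_add, pow_add, two_mul, pow_one, mul_one] at *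
    generalize q ^ n = N at *
    field_simp at z0 z1 z2 z3 z5 z6 z8 h
    refine mul_left_cancel₀ (mul_ne_zero (mul_ne_zero z2 z3) z5) ?_
    linear_combination -h

/-! ### Zero lists and signs of polynomials. -/

theorem isZeroList_of_isRoot {p : ℝ[X]} {n : ℕ} {x : ℕ → ℝ} (hp : p.natDegree = n) (hp0 : p ≠ 0)
    (hx : StrictMonoOn x (Set.Icc 1 n)) (hr : ∀ j ∈ Set.Icc 1 n, p.IsRoot (x j)) :
    IsZeroList p n x := by
  have hS : (Finset.Icc 1 n).image x = p.roots.toFinset := by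
    refine Finset.eq_of_subset_of_card_le (fun t ht => ?_) ?_
    · obtain ⟨j, hj, rfl⟩ := Finset.mem_image.1 ht
      exact Multiset.mem_toFinset.2 ((mem_roots hp0).2 (hr j (by simpa using hj)))
    · rw [Finset.card_image_of_injOn (by simpa using hx.injOn), Nat.card_Icc,
        Nat.add_sub_cancel, ← hp]
      exact (Multiset.toFinset_card_le _).trans (card_roots' p)
  refine ⟨hp, hx, fun t => ?_⟩
  rw [← mem_roots hp0, ← Multiset.mem_toFinset, ← hS]
  simp

/-- A polynomial of degree `n` that changes sign over `n` successive disjoint intervals has exactly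
one zero in each of them and no other. -/
theorem exists_isZeroList_of_sign_changes {p : ℝ[X]} {n : ℕ} (hp : p.natDegree = n) (hp0 : p ≠ 0)
    {l r : ℕ → ℝ} (hlr : ∀ j ∈ Set.Icc 1 n, l j < r j)
    (hsep : ∀ j, 1 ≤ j → j + 1 ≤ n → r j ≤ l (j + 1))
    (hsign : ∀ j ∈ Set.Icc 1 n, p.eval (l j) * p.eval (r j) < 0) :
    ∃ x, IsZeroList p n x ∧ ∀ j ∈ Set.Icc 1 n, l j < x j ∧ x j < r j := by
  have h : ∀ j, ∃ t, j ∈ Set.Icc 1 n → p.IsRoot t ∧ l j < t ∧ t < r j := by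
    intro j
    by_cases hj : j ∈ Set.Icc 1 n
    · have hc : ContinuousOn (fun t => p.eval t) (Set.Icc (l j) (r j)) :=
        p.continuous.continuousOn
      rcases mul_neg_iff.1 (hsign j hj) with h | h
      · obtain ⟨t, ht, ht0⟩ := intermediate_value_Ioo' (hlr j hj).le hc ⟨h.2, h.1⟩
        exact ⟨t, fun _ => ⟨ht0, ht⟩⟩
      · obtain ⟨t, ht, ht0⟩ := intermediate_value_Ioo (hlr j hj).le hc h
        exact ⟨t, fun _ => ⟨ht0, ht⟩⟩
    · exact ⟨0, fun h => absurd h hj⟩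
  choose x hx using h
  refine ⟨x, isZeroList_of_isRoot hp hp0 ?_ fun j hj => (hx j hj).1, fun j hj => (hx j hj).2⟩
  have key : ∀ d i, 1 ≤ i → i + d + 1 ≤ n → x i < x (i + d + 1) := by
    intro d
    have step : ∀ i, 1 ≤ i → i + 1 ≤ n → x i < x (i + 1) := fun i h1 h2 =>
      ((hx i ⟨h1, by lia⟩).2.2.trans_le (hsep i h1 h2)).trans (hx (i + 1) ⟨by lia, h2⟩).2.1
    induction d with
    | zero => exact step
    | succ d ih => exact fun i h1 h2 => (ih i h1 (by lia)).trans (step (i + d + 1) (by lia) h2)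
  intro i hi j hj hij
  obtain ⟨d, rfl⟩ := Nat.exists_eq_add_of_lt hij
  exact key d i hi.1 hj.2

theorem IsZeroList.eq_prod {p : ℝ[X]} {n : ℕ} {x : ℕ → ℝ} (h : IsZeroList p n x) (hp : p.Monic) :
    p = ∏ i ∈ Finset.Icc 1 n, (X - C (x i)) := by
  have hd : ∏ i ∈ Finset.Icc 1 n, (X - C (x i)) ∣ p := by
    refine Finset.prod_dvd_of_coprime (fun i hi j hj hij => ?_) fun i hi => ?_
    · refine isCoprime_X_sub_C_of_isUnit_sub (IsUnit.mk0 _ (sub_ne_zero.2 fun he => hij ?_))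
      exact h.2.1.injOn (by simpa using hi) (by simpa using hj) he
    · exact dvd_iff_isRoot.2 ((h.2.2 _).2 ⟨i, by simpa using hi, rfl⟩)
  refine eq_of_monic_of_dvd_of_natDegree_le (monic_prod_of_monic _ _ fun i _ => monic_X_sub_C _)
    hp hd ?_
  rw [natDegree_prod_of_monic _ _ fun i _ => monic_X_sub_C _, h.1]
  simp

/-- Each of the `n - k` zeros to the right of `t` contributes one minus sign; `n + k` has the same
parity and avoids truncated subtraction. -/
theorem IsZeroList.sign_eval {p : ℝ[X]} {n : ℕ} {x : ℕ → ℝ} (h : IsZeroList p n x) (hp : p.Monic)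
    {k : ℕ} (hk : k ≤ n) {t : ℝ} (hl : ∀ i ∈ Set.Icc 1 k, x i < t)
    (hr : ∀ i ∈ Set.Ioc k n, t < x i) : 0 < (-1) ^ (n + k) * p.eval t := by
  have h1 : ∏ i ∈ Finset.Icc 1 n, (t - x i) =
      (∏ i ∈ Finset.Icc 1 k, (t - x i)) * ∏ i ∈ Finset.Ioc k n, (t - x i) := by
    have := Finset.prod_Ioc_consecutive (fun i => t - x i) (Nat.zero_le k) hk
    exact this.symm
  have h2 : ∏ i ∈ Finset.Ioc k n, (t - x i) =
      (-1) ^ (n + k) * ∏ i ∈ Finset.Ioc k n, (x i - t) := by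
    have h3 : (-1 : ℝ) ^ (n + k) = (-1) ^ (n - k) :=
      neg_one_pow_congr (by simp [Nat.even_add, Nat.even_sub hk])
    rw [h3, ← Nat.card_Ioc, ← Finset.prod_const, ← Finset.prod_mul_distrib]
    exact Finset.prod_congr rfl fun i _ => by ring
  rw [h.eq_prod hp, eval_prod]
  simp only [eval_sub, eval_X, eval_C]
  rw [h1, h2, mul_left_comm, ← mul_assoc ((-1 : ℝ) ^ (n + k)), ← pow_add, (Even.neg_one_pow ⟨_, rfl⟩),
    one_mul]
  exact mul_pos (Finset.prod_pos fun i hi => sub_pos.2 (hl i (by simpa using hi)))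
    (Finset.prod_pos fun i hi => sub_pos.2 (hr i (by simpa using hi)))

theorem exists_gt_eval_pos {p : ℝ[X]} (hp : p.Monic) (hn : 0 < p.natDegree) (b : ℝ) :
    ∃ t, b < t ∧ 0 < p.eval t := by
  have h := tendsto_atTop_of_leadingCoeff_nonneg p (natDegree_pos_iff_degree_pos.1 hn)
    (by rw [hp.leadingCoeff]; exact zero_le_one)
  exact ((Filter.eventually_gt_atTop b).and (h.eventually_gt_atTop 0)).exists

theorem exists_lt_sign_eval {p : ℝ[X]} (hp : p.Monic) (hn : 0 < p.natDegree) (b : ℝ) :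
    ∃ t, t < b ∧ 0 < (-1) ^ p.natDegree * p.eval t := by
  have hd : (C ((-1) ^ p.natDegree) * p.comp (-X)).natDegree = p.natDegree := by
    rw [natDegree_C_mul (by simp), natDegree_comp, natDegree_neg, natDegree_X, mul_one]
  obtain ⟨t, ht, h⟩ := exists_gt_eval_pos (p := C ((-1) ^ p.natDegree) * p.comp (-X)) (by
    rw [Monic, leadingCoeff_mul, leadingCoeff_comp (by simp), hp.leadingCoeff]
    simp [← mul_pow]) (by rwa [hd]) (-b)
  exact ⟨-t, by linarith, by simpa using h⟩

theorem mul_neg_of_signs {i k : ℕ} {u v : ℝ} (hk : Odd (i + k)) (hu : 0 < (-1) ^ i * u)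
    (hv : 0 < (-1) ^ k * v) : u * v < 0 := by
  have h := mul_pos hu hv
  rw [mul_mul_mul_comm, ← pow_add, hk.neg_one_pow] at h
  linarith

theorem IsZeroList.lt_of_lt {p : ℝ[X]} {n : ℕ} {x : ℕ → ℝ} (h : IsZeroList p n x) {i j : ℕ}
    (hi : 1 ≤ i) (hj : j ≤ n) (hij : i < j) : x i < x j :=
  h.2.1 ⟨hi, hij.le.trans hj⟩ ⟨hi.trans hij.le, hj⟩ hij

theorem IsZeroList.le_of_le {p : ℝ[X]} {n : ℕ} {x : ℕ → ℝ} (h : IsZeroList p n x) {i j : ℕ}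
    (hi : 1 ≤ i) (hj : j ≤ n) (hij : i ≤ j) : x i ≤ x j :=
  h.2.1.monotoneOn ⟨hi, hij.trans hj⟩ ⟨hi.trans hij, hj⟩ hij

theorem IsZeroList.eval_eq_zero {p : ℝ[X]} {n : ℕ} {x : ℕ → ℝ} (h : IsZeroList p n x) {j : ℕ}
    (hj : j ∈ Set.Icc 1 n) : p.eval (x j) = 0 :=
  (h.2.2 _).2 ⟨j, hj, rfl⟩

/-! ### Interlacing and perturbation of zeros. -/

section Interlacing

variable {p p' : ℝ[X]} {m : ℕ} {x x' : ℕ → ℝ}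

theorem sign_eval_lower (hx : IsZeroList p (m + 1) x) (hx' : IsZeroList p' m x')
    (hp' : p'.Monic) (hi : ∀ j ∈ Set.Icc 1 m, x j < x' j ∧ x' j < x (j + 1)) {j : ℕ}
    (hj : j ∈ Set.Icc 1 (m + 1)) : 0 < (-1) ^ (m + 1 + j) * p'.eval (x j) := by
  obtain ⟨j, rfl⟩ : ∃ k, j = k + 1 := ⟨j - 1, by have := hj.1; lia⟩
  have hjm : j ≤ m := by have := hj.2; lia
  have h := hx'.sign_eval hp' (k := j) hjm (t := x (j + 1))
    (fun i hi' => (hi i ⟨hi'.1, hi'.2.trans hjm⟩).2.trans_le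
      (hx.le_of_le (by lia) hj.2 (by have := hi'.2; lia)))
    (fun i hi' => (hx.le_of_le (by lia) (by have := hi'.2; lia) hi'.1).trans_lt
      (hi i ⟨by have := hi'.1; lia, hi'.2⟩).1)
  rwa [show m + 1 + (j + 1) = m + j + 2 by ring, pow_add _ _ 2, neg_one_sq, mul_one]

theorem sign_eval_upper (hx : IsZeroList p (m + 1) x) (hp : p.Monic)
    (hi : ∀ j ∈ Set.Icc 1 m, x j < x' j ∧ x' j < x (j + 1)) {j : ℕ}
    (hj : j ∈ Set.Icc 1 m) : 0 < (-1) ^ (m + 1 + j) * p.eval (x' j) :=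
  hx.sign_eval hp (by have := hj.2; lia)
    (fun _ hi' => (hx.le_of_le hi'.1 (by have := hj.2; lia) hi'.2).trans_lt (hi j hj).1)
    (fun _ hi' => (hi j hj).2.trans_le (hx.le_of_le (by lia) hi'.2 hi'.1))

/-- One step of a three-term recurrence with positive last coefficient propagates interlacing. -/
theorem exists_interlacing_succ {p'' : ℝ[X]} {a b c lam : ℝ} (hx : IsZeroList p (m + 1) x)
    (hx' : IsZeroList p' m x') (hp' : p'.Monic)
    (hi : ∀ j ∈ Set.Icc 1 m, x j < x' j ∧ x' j < x (j + 1)) (ha : a < x 1) (hb : x (m + 1) < b)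
    (hp'' : p''.Monic) (hd : p''.natDegree = m + 2) (hlam : 0 < lam)
    (hrec : p'' = (X - C c) * p - C lam * p')
    (hsa : 0 < (-1) ^ (m + 2) * p''.eval a) (hsb : 0 < p''.eval b) :
    ∃ u, IsZeroList p'' (m + 2) u ∧ a < u 1 ∧ u (m + 2) < b ∧
      ∀ j ∈ Set.Icc 1 (m + 1), u j < x j ∧ x j < u (j + 1) := by
  have hs : ∀ j ∈ Set.Icc 1 (m + 1), 0 < (-1) ^ (m + j) * p''.eval (x j) := by
    intro j hj
    have h := mul_pos hlam (sign_eval_lower hx hx' hp' hi hj)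
    rw [hrec]
    simp only [eval_sub, eval_mul, eval_C, hx.eval_eq_zero hj]
    refine lt_of_lt_of_eq h ?_
    ring
  -- The points `a`, `x 1`, …, `x (m + 1)`, `b` bound `m + 2` adjacent intervals; at each `x j` the
  -- recurrence leaves only `-lam * p'`.
  obtain ⟨u, hu, hlr⟩ := exists_isZeroList_of_sign_changes hd hp''.ne_zero
    (l := fun j => if j = 1 then a else x (j - 1)) (r := fun j => if j = m + 2 then b else x j)
    (by
      rintro j ⟨h1, h2⟩
      split_ifs with h3 h4 h4
      · exact absurd h4 (by lia)
      · rw [h3]; exact ha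
      · rw [h4]; exact hb
      · exact hx.lt_of_lt (by lia) (by lia) (by lia))
    (by
      intro j h1 h2
      rw [if_neg (by lia), if_neg (by lia), Nat.add_sub_cancel])
    (by
      rintro j ⟨h1, h2⟩
      split_ifs with h3 h4 h4
      · exact absurd h4 (by lia)
      · subst h3
        exact mul_neg_of_signs (i := m + 2) (k := m + 1) ⟨m + 1, by ring⟩ hsa
          (hs 1 ⟨le_rfl, by lia⟩)
      · subst h4
        exact mul_neg_of_signs (i := m + (m + 2 - 1)) (k := 0) ⟨m, by lia⟩
          (hs _ ⟨by lia, by lia⟩) (by simpa using hsb)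
      · exact mul_neg_of_signs (i := m + (j - 1)) (k := m + j) ⟨m + j - 1, by lia⟩
          (hs _ ⟨by lia, by lia⟩) (hs _ ⟨by lia, by lia⟩))
  refine ⟨u, hu, by simpa using (hlr 1 ⟨le_rfl, by lia⟩).1,
    by simpa using (hlr (m + 2) ⟨by lia, le_rfl⟩).2, fun j hj => ⟨?_, ?_⟩⟩
  · have := (hlr j ⟨hj.1, by have := hj.2; lia⟩).2
    rwa [if_neg (by have := hj.2; lia)] at this
  · have := (hlr (j + 1) ⟨by lia, by have := hj.2; lia⟩).1
    rwa [if_neg (by have := hj.1; lia), Nat.add_sub_cancel] at this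

theorem monic_add_C_mul {a : ℝ} (hp : p.Monic) (hd : p.natDegree = m + 1)
    (hd' : p'.natDegree = m) :
    (p + C a * p').Monic ∧ (p + C a * p').natDegree = m + 1 := by
  have hlt : (C a * p').natDegree < p.natDegree := by
    rw [hd]; exact (natDegree_C_mul_le a p').trans_lt (by lia)
  exact ⟨hp.add_of_left (degree_lt_degree hlt), by rw [natDegree_add_eq_left_of_natDegree_lt hlt, hd]⟩

/-- For `a < 0` the sum has opposite signs at `x j` and `x' j`, which gives `m` zeros; the last one
lies between `x (m + 1)` and a far point where the sum is positive. -/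
theorem exists_isZeroList_add_neg {a : ℝ} (hx : IsZeroList p (m + 1) x)
    (hx' : IsZeroList p' m x') (hp : p.Monic) (hp' : p'.Monic)
    (hi : ∀ j ∈ Set.Icc 1 m, x j < x' j ∧ x' j < x (j + 1)) (ha : a < 0) :
    ∃ y, IsZeroList (p + C a * p') (m + 1) y ∧ (∀ j ∈ Set.Icc 1 (m + 1), x j < y j) ∧
      ∀ j ∈ Set.Icc 1 m, y j < x' j := by
  obtain ⟨hQ, hd⟩ := monic_add_C_mul (a := a) hp hx.1 hx'.1
  obtain ⟨B, hB, hBs⟩ := exists_gt_eval_pos hQ (by lia) (x (m + 1))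
  have hs : ∀ j ∈ Set.Icc 1 (m + 1), 0 < (-1) ^ (m + j) * (p + C a * p').eval (x j) := by
    intro j hj
    have h := mul_pos (neg_pos.2 ha) (sign_eval_lower hx hx' hp' hi hj)
    simp only [eval_add, eval_mul, eval_C, hx.eval_eq_zero hj]
    refine lt_of_lt_of_eq h ?_
    ring
  have hs' : ∀ j ∈ Set.Icc 1 m, 0 < (-1) ^ (m + 1 + j) * (p + C a * p').eval (x' j) := by
    intro j hj
    simpa [hx'.eval_eq_zero hj] using sign_eval_upper hx hp hi hj
  obtain ⟨y, hy, hlr⟩ := exists_isZeroList_of_sign_changes hd hQ.ne_zero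
    (l := x) (r := fun j => if j = m + 1 then B else x' j)
    (by
      rintro j ⟨h1, h2⟩
      split_ifs with h3
      · rw [h3]; exact hB
      · exact (hi j ⟨h1, by lia⟩).1)
    (by
      intro j h1 h2
      rw [if_neg (by lia)]
      exact (hi j ⟨h1, by lia⟩).2.le)
    (by
      rintro j ⟨h1, h2⟩
      split_ifs with h3
      · subst h3
        exact mul_neg_of_signs (i := m + (m + 1)) (k := 0) ⟨m, by ring⟩ (hs _ ⟨h1, h2⟩)
          (by simpa using hBs)
      · exact mul_neg_of_signs (i := m + j) (k := m + 1 + j) ⟨m + j, by ring⟩ (hs j ⟨h1, h2⟩)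
          (hs' j ⟨h1, by lia⟩))
  refine ⟨y, hy, fun j hj => (hlr j hj).1, fun j hj => ?_⟩
  have := (hlr j ⟨hj.1, by have := hj.2; lia⟩).2
  rwa [if_neg (by have := hj.2; lia)] at this

/-- For `a > 0` the sign changes fall between `x' j` and `x (j + 1)`, and the remaining zero lies to
the left of `B`. The free point `B` is γq in (ii) and `x 1` in (iii). -/
theorem exists_isZeroList_add_pos {a B : ℝ} (hx : IsZeroList p (m + 1) x)
    (hx' : IsZeroList p' m x') (hp : p.Monic) (hp' : p'.Monic)
    (hi : ∀ j ∈ Set.Icc 1 m, x j < x' j ∧ x' j < x (j + 1)) (ha : 0 < a)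
    (hB : B ≤ x 1) (hBs : 0 < (-1) ^ m * (p + C a * p').eval B) :
    ∃ z, IsZeroList (p + C a * p') (m + 1) z ∧ z 1 < B ∧
      (∀ j ∈ Set.Icc 1 (m + 1), z j < x j) ∧ ∀ j ∈ Set.Icc 1 m, x' j < z (j + 1) := by
  obtain ⟨hQ, hd⟩ := monic_add_C_mul (a := a) hp hx.1 hx'.1
  obtain ⟨A, hA, hAs⟩ := exists_lt_sign_eval hQ (by lia) B
  rw [hd] at hAs
  have hs : ∀ j ∈ Set.Icc 1 (m + 1), 0 < (-1) ^ (m + 1 + j) * (p + C a * p').eval (x j) := by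
    intro j hj
    have h := mul_pos ha (sign_eval_lower hx hx' hp' hi hj)
    simp only [eval_add, eval_mul, eval_C, hx.eval_eq_zero hj]
    refine lt_of_lt_of_eq h ?_
    ring
  have hs' : ∀ j ∈ Set.Icc 1 m, 0 < (-1) ^ (m + 1 + j) * (p + C a * p').eval (x' j) := by
    intro j hj
    simpa [hx'.eval_eq_zero hj] using sign_eval_upper hx hp hi hj
  obtain ⟨z, hz, hlr⟩ := exists_isZeroList_of_sign_changes hd hQ.ne_zero
    (l := fun j => if j = 1 then A else x' (j - 1)) (r := fun j => if j = 1 then B else x j)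
    (by
      rintro j ⟨h1, h2⟩
      split_ifs with h3
      · exact hA
      · have := (hi (j - 1) ⟨by lia, by lia⟩).2
        rwa [Nat.sub_add_cancel h1] at this)
    (by
      intro j h1 h2
      rw [if_neg (show ¬ j + 1 = 1 by lia), Nat.add_sub_cancel]
      have := (hi j ⟨h1, by lia⟩).1
      split_ifs with h3
      · subst h3; exact hB.trans this.le
      · exact this.le)
    (by
      rintro j ⟨h1, h2⟩
      split_ifs with h3
      · exact mul_neg_of_signs (i := m + 1) (k := m) ⟨m, by ring⟩ hAs hBs
      · exact mul_neg_of_signs (i := m + 1 + (j - 1)) (k := m + 1 + j) ⟨m + j, by lia⟩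
          (hs' _ ⟨by lia, by lia⟩) (hs j ⟨h1, h2⟩))
  have h1 : z 1 < B := by simpa using (hlr 1 ⟨le_rfl, by lia⟩).2
  refine ⟨z, hz, h1, fun j hj => ?_, fun j hj => ?_⟩
  · have := (hlr j hj).2
    split_ifs at this with h3
    · subst h3; exact this.trans_le hB
    · exact this
  · have := (hlr (j + 1) ⟨by lia, by have := hj.2; lia⟩).1
    rwa [if_neg (by have := hj.1; lia), Nat.add_sub_cancel] at this

/-- Used for (iv), where signs are known only at the zeros of `p'` and at `B`: they give `m - 1`
zeros between the `x' j`, one to the right of `x' m` and one to the left of `B`. -/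
theorem exists_isZeroList_of_sign_eval {Q : ℝ[X]} {B : ℝ} (hm : 2 ≤ m) (hQ : Q.Monic)
    (hd : Q.natDegree = m + 1) (hx' : IsZeroList p' m x')
    (hs : ∀ j ∈ Set.Icc 1 m, 0 < (-1) ^ (m + 1 + j) * Q.eval (x' j))
    (hB : B ≤ x' 1) (hBs : 0 < (-1) ^ m * Q.eval B) :
    ∃ v, IsZeroList Q (m + 1) v ∧ v 1 < B := by
  obtain ⟨A, hA, hAs⟩ := exists_lt_sign_eval hQ (by lia) B
  obtain ⟨D, hD, hDs⟩ := exists_gt_eval_pos hQ (by lia) (x' m)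
  rw [hd] at hAs
  obtain ⟨v, hv, hlr⟩ := exists_isZeroList_of_sign_changes hd hQ.ne_zero
    (l := fun j => if j = 1 then A else x' (j - 1))
    (r := fun j => if j = 1 then B else if j = m + 1 then D else x' j)
    (by
      rintro j ⟨h1, h2⟩
      split_ifs with h3 h4
      · exact hA
      · subst h4; exact hD
      · exact hx'.lt_of_lt (by lia) (by lia) (by lia))
    (by
      intro j h1 h2
      rw [if_neg (show ¬ j + 1 = 1 by lia), Nat.add_sub_cancel, if_neg (show ¬ j = m + 1 by lia)]
      split_ifs with h3
      · subst h3; exact hB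
      · exact le_rfl)
    (by
      rintro j ⟨h1, h2⟩
      split_ifs with h3 h4
      · exact mul_neg_of_signs (i := m + 1) (k := m) ⟨m, by ring⟩ hAs hBs
      · subst h4
        exact mul_neg_of_signs (i := m + 1 + (m + 1 - 1)) (k := 0) ⟨m, by lia⟩
          (hs _ ⟨by lia, by lia⟩) (by simpa using hDs)
      · exact mul_neg_of_signs (i := m + 1 + (j - 1)) (k := m + 1 + j) ⟨m + j, by lia⟩
          (hs _ ⟨by lia, by lia⟩) (hs j ⟨h1, by lia⟩))
  exact ⟨v, hv, by simpa using (hlr 1 ⟨le_rfl, by lia⟩).2⟩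

end Interlacing

/-! ### Parameters in the orthogonality range. -/

theorem mul_pow_lt_of_le {a b q : ℝ} {k l : ℕ} (hq0 : 0 < q) (hq1 : q < 1) (hb : 0 ≤ b)
    (h : a * q ^ k < b) (hkl : k ≤ l) : a * q ^ l < b := by
  obtain ⟨d, rfl⟩ := Nat.exists_eq_add_of_le hkl
  rcases le_or_gt a 0 with ha | ha
  · rcases hb.eq_or_lt with rfl | hb
    · have ha' : a < 0 := by
        have := pow_pos hq0 k
        by_contra h0
        exact absurd h (by nlinarith)
      exact mul_neg_of_neg_of_pos ha' (pow_pos hq0 _)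
    · exact (mul_nonpos_of_nonpos_of_nonneg ha (pow_pos hq0 _).le).trans_lt hb
  · refine lt_of_le_of_lt ?_ h
    exact mul_le_mul_of_nonneg_left (pow_le_pow_of_le_one hq0.le hq1.le (by lia)) ha.le

/-- The parameters `α`, `γ`, `s = αβ` of big `q`-Jacobi polynomials with `αq < 1`, `0 < βq < 1` and
`γ < 0`, for which they are orthogonal on `(γq, αq)`. -/
structure IsOrthogonalParam (α γ s q : ℝ) : Prop where
  q_pos : 0 < q
  q_lt_one : q < 1
  left_lt_one : α * q < 1
  right_neg : γ < 0
  prod_pos : 0 < s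
  prod_lt : s * q < α

namespace IsOrthogonalParam

variable {α γ s q : ℝ} (h : IsOrthogonalParam α γ s q)

include h

theorem left_pos : 0 < α := (mul_pos h.prod_pos h.q_pos).trans h.prod_lt

theorem left_lt (j : ℕ) : α * q ^ (j + 1) < 1 :=
  mul_pow_lt_of_le h.q_pos h.q_lt_one zero_le_one (k := 1) (by simpa using h.left_lt_one) (by lia)

theorem right_lt (j : ℕ) : γ * q ^ j < 1 :=
  (mul_neg_of_neg_of_pos h.right_neg (pow_pos h.q_pos _)).trans one_pos

theorem prod_lt_left (j : ℕ) : s * q ^ (j + 1) < α :=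
  mul_pow_lt_of_le h.q_pos h.q_lt_one h.left_pos.le (k := 1) (by simpa using h.prod_lt) (by lia)

theorem prod_lt_one {j : ℕ} (hj : 2 ≤ j) : s * q ^ j < 1 := by
  refine mul_pow_lt_of_le h.q_pos h.q_lt_one zero_le_one (k := 2) ?_ hj
  have := mul_lt_mul_of_pos_right h.prod_lt h.q_pos
  rw [sq, ← mul_assoc]
  exact this.trans h.left_lt_one

theorem left_ne (j : ℕ) : α * q ^ (j + 1) ≠ 1 := (h.left_lt j).ne

theorem right_ne (j : ℕ) : γ * q ^ (j + 1) ≠ 1 := (h.right_lt _).ne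

theorem prod_ne (j : ℕ) : s * q ^ (j + 2) ≠ 1 := (h.prod_lt_one (by lia)).ne

theorem jacobiScale_pos (n : ℕ) : 0 < jacobiScale n α γ s q := by
  rcases n with _ | n
  · simp [jacobiScale]
  · exact _root_.jacobiScale_pos h.left_lt (fun j => h.right_lt _)
      fun j => h.prod_lt_one (by lia)

/-- Positivity of `lam` comes from `γ < 0 < s * q ^ (n + 1) < α`. -/
theorem exists_recurrence (n : ℕ) : ∃ c lam : ℝ, 0 < lam ∧ monicJacobi (n + 2) α γ s q =
    (X - C c) * monicJacobi (n + 1) α γ s q - C lam * monicJacobi n α γ s q := by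
  refine ⟨_, _, div_pos (mul_pos (div_pos ?_ (mul_pos ?_ ?_)) (h.jacobiScale_pos _))
    (h.jacobiScale_pos _),
    monicJacobi_recurrence h.q_pos h.q_lt_one n α γ s h.left_ne h.right_ne h.prod_ne⟩
  · have h1 : 0 < s * q ^ (n + 1) := mul_pos h.prod_pos (pow_pos h.q_pos _)
    have h2 := h.right_neg
    have h3 : 0 < q ^ (n + 1 + 1) * (1 - q ^ (n + 1)) :=
      mul_pos (pow_pos h.q_pos _) (sub_pos.2 (pow_lt_one₀ h.q_pos.le h.q_lt_one n.succ_ne_zero))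
    have h4 := mul_pos (mul_pos h3 (show 0 < s * q ^ (n + 1) - γ by linarith))
      (sub_pos.2 (h.prod_lt_left n))
    linarith
  · exact sub_pos.2 (h.prod_lt_one (by lia))
  · exact sub_pos.2 (h.prod_lt_one (by lia))

theorem monicJacobi_one_eq : monicJacobi 1 α γ s q = X - C (1 - jacobiScale 1 α γ s q) :=
  monicJacobi_one h.q_pos h.q_lt_one α γ s (by simpa using h.left_ne 0)
    (by simpa using h.right_ne 0) (h.prod_ne 0)

/-- Going through the recurrence avoids extracting the leading coefficient from the series. -/
theorem monic_and_natDegree (n : ℕ) :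
    (monicJacobi n α γ s q).Monic ∧ (monicJacobi n α γ s q).natDegree = n := by
  induction n using Nat.strong_induction_on with
  | _ n ih =>
    match n, ih with
    | 0, _ => simp [monicJacobi_zero]
    | 1, _ => rw [h.monicJacobi_one_eq]; exact ⟨monic_X_sub_C _, natDegree_X_sub_C _⟩
    | n + 2, ih =>
      obtain ⟨c, lam, -, hrec⟩ := h.exists_recurrence n
      obtain ⟨h0, d0⟩ := ih n (by lia)
      obtain ⟨h1, d1⟩ := ih (n + 1) (by lia)
      have hp : ((X - C c) * monicJacobi (n + 1) α γ s q).Monic := (monic_X_sub_C c).mul h1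
      have hd : ((X - C c) * monicJacobi (n + 1) α γ s q).natDegree = n + 1 + 1 := by
        rw [(monic_X_sub_C c).natDegree_mul h1, natDegree_X_sub_C, d1, add_comm]
      have hlt : (C lam * monicJacobi n α γ s q).natDegree <
          ((X - C c) * monicJacobi (n + 1) α γ s q).natDegree := by
        rw [hd]
        exact (natDegree_C_mul_le _ _).trans_lt (by lia)
      rw [hrec]
      exact ⟨hp.sub_of_left (degree_lt_degree hlt),
        by rw [natDegree_sub_eq_left_of_natDegree_lt hlt, hd]⟩

theorem monic (n : ℕ) : (monicJacobi n α γ s q).Monic := (h.monic_and_natDegree n).1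

theorem natDegree_eq (n : ℕ) : (monicJacobi n α γ s q).natDegree = n := (h.monic_and_natDegree n).2

theorem sign_eval_left (n : ℕ) : 0 < (-1) ^ n * (monicJacobi n α γ s q).eval (γ * q) := by
  have key : 0 < (-1) ^ n * (jacobiPhi n α γ s q).eval (γ * q) := by
    induction n with
    | zero => simp [jacobiPhi_zero]
    | succ n ih =>
      have e := jacobiPhi_eval_succ h.q_pos h.q_lt_one α γ s h.left_ne h.right_ne h.prod_ne n
      have h1 := sub_pos.2 (h.left_lt n)
      have h2 := mul_pos (mul_pos (pow_pos h.q_pos (n + 1)) (sub_pos.2 (h.prod_lt_left n))) ih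
      refine pos_of_mul_pos_right (lt_of_lt_of_eq h2 ?_) h1.le
      linear_combination (-1) ^ n * e
  have := mul_pos (h.jacobiScale_pos n) key
  rw [monicJacobi, eval_mul, eval_C]
  linarith

theorem eval_right_pos (n : ℕ) : 0 < (monicJacobi n α γ s q).eval (α * q) := by
  have key : 0 < (jacobiPhi n α γ s q).eval (α * q) := by
    induction n with
    | zero => simp [jacobiPhi_zero]
    | succ n ih =>
      have e := jacobiPhi_eval_succ h.q_pos h.q_lt_one γ α s h.right_ne h.left_ne h.prod_ne n
      rw [jacobiPhi_swap _ γ, jacobiPhi_swap _ γ] at e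
      have h0 : 0 < s * q ^ (n + 1) := mul_pos h.prod_pos (pow_pos h.q_pos _)
      have h1 := sub_pos.2 (h.right_lt (n + 1))
      have h2 := mul_pos (mul_pos (pow_pos h.q_pos (n + 1))
        (show 0 < s * q ^ (n + 1) - γ by linarith [h.right_neg])) ih
      refine pos_of_mul_pos_right (lt_of_lt_of_eq h2 ?_) h1.le
      rw [e]
      ring
  rw [monicJacobi, eval_mul, eval_C]
  exact mul_pos (h.jacobiScale_pos n) key

theorem exists_interlacing (m : ℕ) : ∃ x x' : ℕ → ℝ,
    IsZeroList (monicJacobi (m + 1) α γ s q) (m + 1) x ∧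
    IsZeroList (monicJacobi m α γ s q) m x' ∧
    (∀ j ∈ Set.Icc 1 m, x j < x' j ∧ x' j < x (j + 1)) ∧ γ * q < x 1 ∧ x (m + 1) < α * q := by
  induction m with
  | zero =>
    have hl := h.sign_eval_left 1
    have hr := h.eval_right_pos 1
    have e := h.monicJacobi_one_eq
    generalize 1 - jacobiScale 1 α γ s q = c at e
    rw [e] at hl hr
    simp only [pow_one, eval_sub, eval_X, eval_C] at hl hr
    -- The second list is for the constant polynomial 1, so its values are irrelevant.
    refine ⟨fun _ => c, fun _ => 0, ?_, ?_, fun j hj => ?_, by linarith, by linarith⟩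
    · rw [e]
      refine isZeroList_of_isRoot (natDegree_X_sub_C c) (X_sub_C_ne_zero c) ?_ fun j _ => by simp
      rintro i ⟨hi1, hi2⟩ j ⟨hj1, hj2⟩ hij
      exact absurd hij (by lia)
    · rw [monicJacobi_zero]
      refine isZeroList_of_isRoot natDegree_one one_ne_zero ?_ fun j hj => ?_
      · rintro i ⟨hi1, hi2⟩ j ⟨hj1, hj2⟩ hij
        exact absurd hij (by lia)
      · exact absurd (hj.1.trans hj.2) (by lia)
    · exact absurd (hj.1.trans hj.2) (by lia)
  | succ m ih =>
    obtain ⟨x, x', hx, hx', hi, ha, hb⟩ := ih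
    obtain ⟨c, lam, hlam, hrec⟩ := h.exists_recurrence m
    obtain ⟨u, hu, hua, hub, hui⟩ := exists_interlacing_succ hx hx' (h.monic m) hi ha hb
      (h.monic (m + 2)) (h.natDegree_eq (m + 2)) hlam hrec (h.sign_eval_left (m + 2))
      (h.eval_right_pos (m + 2))
    exact ⟨u, x, hu, hx, hui, hua, hub⟩

/-- The shift of `α` is applied with `γ` in its place. The factor `γ - s * q ^ (m + 1)` is negative,
unlike its counterpart for `α`, hence the opposite sign of the coefficient. -/
theorem exists_contiguous_right {m : ℕ} (hm : 1 ≤ m) : ∃ a : ℝ, 0 < a ∧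
    monicJacobi (m + 1) α (γ / q) (s / q) q =
      monicJacobi (m + 1) α γ s q + C a * monicJacobi m α γ s q := by
  have hq := h.q_pos.ne'
  have e := monicJacobi_contiguous_left h.q_pos h.q_lt_one m (γ / q) α (s / q)
    (fun j => by
      rw [pow_succ', ← mul_assoc, div_mul_cancel₀ _ hq]; exact (h.right_lt j).ne) h.left_ne
    (fun j => by
      rw [show m + 2 + j = m + 1 + j + 1 by ring, pow_succ', ← mul_assoc, div_mul_cancel₀ _ hq]
      exact (h.prod_lt_one (by lia)).ne)
  rw [div_mul_cancel₀ _ hq, div_mul_cancel₀ _ hq, monicJacobi_swap _ (γ / q),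
    monicJacobi_swap _ γ, monicJacobi_swap _ γ] at e
  refine ⟨_, div_pos ?_ (mul_pos ?_ ?_), e⟩
  · have h1 : 0 < s / q * q ^ (m + 1) := mul_pos (div_pos h.prod_pos h.q_pos) (pow_pos h.q_pos _)
    have h2 : γ / q < 0 := div_neg_of_neg_of_pos h.right_neg h.q_pos
    have h3 : 0 < q * (1 - q ^ (m + 1)) :=
      mul_pos h.q_pos (sub_pos.2 (pow_lt_one₀ h.q_pos.le h.q_lt_one m.succ_ne_zero))
    have h4 := mul_pos (mul_pos h3 (show 0 < s / q * q ^ (m + 1) - γ / q by linarith))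
      (sub_pos.2 (h.left_lt m))
    linarith
  · rw [pow_succ' _ (2 * m + 1), ← mul_assoc, div_mul_cancel₀ _ hq]
    exact sub_pos.2 (h.prod_lt_one (by lia))
  · rw [pow_succ' _ (2 * m + 2), ← mul_assoc, div_mul_cancel₀ _ hq]
    exact sub_pos.2 (h.prod_lt_one (by lia))

/-- `α < s` means β > 1. It makes `k` positive, since `k` carries the factor `s - α`, obtained by
inserting the ratio from `jacobiPhi_eval_succ`. -/
theorem exists_contiguous_both {m : ℕ} (hm : 1 ≤ m) (hs : α < s) : ∃ b k : ℝ, 0 < b ∧ 0 < k ∧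
    monicJacobi (m + 1) α γ (s / q) q =
      monicJacobi (m + 1) α γ s q + C b * monicJacobi m α γ s q ∧
    (monicJacobi (m + 1) α γ (s / q) q).eval (γ * q) =
      k * (monicJacobi m α γ s q).eval (γ * q) := by
  have hq := h.q_pos.ne'
  have hdiv : ∀ j, s / q * q ^ (j + 1) = s * q ^ j := fun j => by
    rw [pow_succ', ← mul_assoc, div_mul_cancel₀ _ hq]
  have e := monicJacobi_contiguous_both h.q_pos h.q_lt_one m α γ (s / q) h.left_ne h.right_ne
    (fun j => by
      rw [show m + 2 + j = m + 1 + j + 1 by ring, hdiv]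
      exact (h.prod_lt_one (by lia)).ne)
  rw [div_mul_cancel₀ _ hq, hdiv, hdiv] at e
  have z1 := sub_pos.2 (h.prod_lt_one (show 2 ≤ 2 * m + 1 by lia))
  have z2 := sub_pos.2 (h.prod_lt_one (show 2 ≤ 2 * m + 2 by lia))
  have z3 := sub_pos.2 (h.left_lt m)
  have z4 := sub_pos.2 (h.right_lt (m + 1))
  have z5 := sub_pos.2 (pow_lt_one₀ h.q_pos.le h.q_lt_one m.succ_ne_zero)
  have z6 := pow_pos h.q_pos (m + 1)
  refine ⟨_, q ^ (m + 1) * (1 - γ * q ^ (m + 1)) * (s - α) / (1 - s * q ^ (2 * m + 1)),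
    div_pos (mul_pos (mul_pos (mul_pos (mul_pos h.prod_pos z6) z5) z3) z4) (mul_pos z1 z2),
    div_pos (mul_pos (mul_pos z6 z4) (sub_pos.2 hs)) z1, e, ?_⟩
  have e2 := jacobiPhi_eval_succ h.q_pos h.q_lt_one α γ s h.left_ne h.right_ne h.prod_ne m
  rw [e, eval_add, eval_mul, eval_C]
  simp only [monicJacobi, eval_mul, eval_C]
  rw [jacobiScale_succ m α γ s fun j => (h.prod_lt_one (by lia)).ne, recurrenceUp]
  generalize (jacobiPhi m α γ s q).eval (γ * q) = v0 at *
  have e3 : (jacobiPhi (m + 1) α γ s q).eval (γ * q) =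
      -(q ^ (m + 1) * (α - s * q ^ (m + 1))) * v0 / (1 - α * q ^ (m + 1)) := by
    rw [eq_div_iff z3.ne', ← e2]; ring
  rw [e3]
  have w1 := z1.ne'
  have w2 := z2.ne'
  have w3 := z3.ne'
  clear e e2 e3 hdiv z1 z2 z3 z4 z5 z6
  simp only [pow_add, two_mul, pow_one] at *
  generalize q ^ m = N at *
  field_simp at w1 w2 w3 ⊢
  ring

end IsOrthogonalParam

/-! ### Division of `α` by `q`, and assembly of the four cases. -/

/-- Stated outside `IsOrthogonalParam` because (iv) applies it after `β` has been divided by `q`,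
when `s * q < α` fails. -/
theorem exists_contiguous_left {α γ s q : ℝ} (hq0 : 0 < q) (hq1 : q < 1) (hα : 1 < α)
    (hα1 : α * q < 1) (hγ : γ < 0) {m : ℕ} (hs : s * q ^ (m + 1) < 1) : ∃ a : ℝ, a < 0 ∧
    monicJacobi (m + 1) (α / q) γ (s / q) q =
      monicJacobi (m + 1) α γ s q + C a * monicJacobi m α γ s q := by
  have hq := hq0.ne'
  have hdiv : ∀ t j, t / q * q ^ (j + 1) = t * q ^ j := fun t j => by
    rw [pow_succ', ← mul_assoc, div_mul_cancel₀ _ hq]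
  have hs' : ∀ j, m + 1 ≤ j → s * q ^ j < 1 := fun j hj =>
    mul_pow_lt_of_le hq0 hq1 zero_le_one hs hj
  have hγ' : ∀ j, γ * q ^ j < 1 := fun j =>
    (mul_neg_of_neg_of_pos hγ (pow_pos hq0 _)).trans one_pos
  have e := monicJacobi_contiguous_left hq0 hq1 m (α / q) γ (s / q)
    (fun j => by
      rw [hdiv]
      -- At `j = 0` the condition is `α ≠ 1`, which comes from `1 < α`; for larger `j` it follows
      -- from `α * q < 1`.
      rcases j with _ | j
      · simpa using hα.ne'
      · exact (mul_pow_lt_of_le hq0 hq1 zero_le_one (k := 1) (by simpa using hα1) (by lia)).ne)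
    (fun j => (hγ' _).ne)
    (fun j => by
      rw [show m + 2 + j = m + 1 + j + 1 by ring, hdiv]
      exact (hs' _ (by lia)).ne)
  rw [div_mul_cancel₀ _ hq, div_mul_cancel₀ _ hq] at e
  refine ⟨_, div_neg_of_neg_of_pos (neg_neg_of_pos ?_) (mul_pos ?_ ?_), e⟩
  · have h2 : α / q - s / q * q ^ (m + 1) = (α - s * q ^ (m + 1)) / q := by ring
    rw [h2]
    exact mul_pos (mul_pos (mul_pos hq0 (sub_pos.2 (pow_lt_one₀ hq0.le hq1 m.succ_ne_zero)))
      (div_pos (by linarith) hq0)) (sub_pos.2 (hγ' _))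
  · rw [hdiv]
    exact sub_pos.2 (hs' _ (by lia))
  · rw [hdiv]
    exact sub_pos.2 (hs' _ (by lia))

/-- The case in which both `α` and `β` are divided by `q`. -/
theorem IsOrthogonalParam.exists_isZeroList_both {α γ s q : ℝ} (h : IsOrthogonalParam α γ s q)
    (hα : 1 < α) (hs : α < s) {m : ℕ} (hm : 2 ≤ m) :
    ∃ v, IsZeroList (monicJacobi (m + 1) (α / q) γ (s / q / q) q) (m + 1) v ∧ v 1 < γ * q := by
  have hq := h.q_pos.ne'
  obtain ⟨k, rfl⟩ : ∃ k, m = k + 1 := ⟨m - 1, by lia⟩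
  obtain ⟨x, x', hx, hx', hi, hγx, -⟩ := h.exists_interlacing (k + 1)
  obtain ⟨b, κ, -, hκ, hZ, hZv⟩ := h.exists_contiguous_both (m := k + 1) (by lia) hs
  obtain ⟨b', κ', hb', hκ', hZ', hZv'⟩ := h.exists_contiguous_both (m := k) (by lia) hs
  obtain ⟨a, ha, hQ⟩ := exists_contiguous_left h.q_pos h.q_lt_one hα h.left_lt_one h.right_neg
    (m := k + 1) (s := s / q) (by
      rw [pow_succ', ← mul_assoc, div_mul_cancel₀ _ hq]
      exact h.prod_lt_one (by lia))
  obtain ⟨c, lam, hlam, hrec⟩ := h.exists_recurrence k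
  obtain ⟨mZ, dZ⟩ := monic_add_C_mul (a := b) (h.monic (k + 1 + 1)) (h.natDegree_eq _)
    (h.natDegree_eq (k + 1))
  obtain ⟨mZ', dZ'⟩ := monic_add_C_mul (a := b') (h.monic (k + 1)) (h.natDegree_eq _)
    (h.natDegree_eq k)
  rw [← hZ] at mZ dZ
  rw [← hZ'] at mZ' dZ'
  obtain ⟨mQ, dQ⟩ := monic_add_C_mul (a := a) mZ dZ dZ'
  rw [hQ]
  refine exists_isZeroList_of_sign_eval hm mQ dQ hx' (fun j hj => ?_)
    (hγx.trans (hi 1 ⟨le_rfl, by lia⟩).1).le ?_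
  · have h1 := sign_eval_upper hx (h.monic _) hi hj
    have h0 := hx'.eval_eq_zero hj
    -- At a zero of P_{k+1} the polynomial equals P_{k+2} + a b' P_k, and P_{k+2} = -lam P_k there;
    -- since `a * b' < 0`, both terms have the same sign.
    have h2 : (monicJacobi (k + 1 + 1) α γ s q).eval (x' j) =
        -lam * (monicJacobi k α γ s q).eval (x' j) := by
      rw [show k + 1 + 1 = k + 2 from rfl, hrec]
      simp [h0]
    rw [hZ, hZ']
    simp only [eval_add, eval_mul, eval_C, h0]
    rw [h2] at h1 ⊢
    have h3 : 0 < (-1) ^ (k + 1 + 1 + j) * -(monicJacobi k α γ s q).eval (x' j) := by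
      refine pos_of_mul_pos_right (lt_of_lt_of_eq h1 ?_) hlam.le
      ring
    have h4 := mul_pos (mul_pos (neg_pos.2 ha) hb') h3
    linarith
  -- At γq the values of P_{k+1} and P_k have opposite signs and `a < 0`, so the two terms reinforce
  -- each other.
  · have h1 := mul_pos hκ (h.sign_eval_left (k + 1))
    have h2 := mul_pos (mul_pos (neg_pos.2 ha) hκ') (h.sign_eval_left k)
    rw [eval_add, eval_mul, eval_C, hZv, hZv']
    rw [pow_succ] at h1 ⊢
    linarith

end

theorem theorem2p4 (n : ℕ) (hn : 2 ≤ n) (q α β γ : ℝ)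
    (hq0 : 0 < q) (hq1 : q < 1)
    (hα0 : 0 < α * q) (hα1 : α * q < 1) (hβ0 : 0 < β * q) (hβ1 : β * q < 1) (hγ : γ < 0) :
    ∃ x x' : ℕ → ℝ,
      IsZeroList (bigQJacobi n α β γ q) n x ∧
      IsZeroList (bigQJacobi (n - 1) α β γ q) (n - 1) x' ∧
      (1 < α → ∃ y : ℕ → ℝ, IsZeroList (bigQJacobi n (α / q) β γ q) n y ∧
        γ * q < x 1 ∧
        (∀ j ∈ Set.Icc 1 n, x j < y j) ∧
        (∀ j ∈ Set.Icc 1 (n - 1), y j < x' j ∧ x' j < x (j + 1))) ∧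
      (1 < β → ∃ z : ℕ → ℝ, IsZeroList (bigQJacobi n α (β / q) γ q) n z ∧
        z 1 < γ * q ∧ γ * q < x 1 ∧
        (∀ j ∈ Set.Icc 1 n, z j < x j) ∧
        (∀ j ∈ Set.Icc 1 (n - 1), x j < x' j ∧ x' j < z (j + 1)) ∧
        x n < α * q) ∧
      (1 < β → ∃ w : ℕ → ℝ, IsZeroList (bigQJacobi n α (β / q) (γ / q) q) n w ∧
        (∀ j ∈ Set.Icc 1 n, w j < x j) ∧
        (∀ j ∈ Set.Icc 1 (n - 1), x j < x' j ∧ x' j < w (j + 1)) ∧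
        x n < α * q) ∧
      (3 ≤ n → 1 < α → 1 < β →
        ∃ v : ℕ → ℝ, IsZeroList (bigQJacobi n (α / q) (β / q) γ q) n v ∧ v 1 < γ * q) := by
  obtain ⟨m, rfl⟩ : ∃ m, n = m + 1 := ⟨n - 1, by lia⟩
  have hα : 0 < α := pos_of_mul_pos_left hα0 hq0.le
  have hβ : 0 < β := pos_of_mul_pos_left hβ0 hq0.le
  have h : IsOrthogonalParam α γ (α * β) q :=
    ⟨hq0, hq1, hα1, hγ, mul_pos hα hβ, by
      rw [mul_assoc]; exact mul_lt_of_lt_one_right hα hβ1⟩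
  have hs : 1 < β → α < α * β := fun hβ' => lt_mul_of_one_lt_right hα hβ'
  simp only [bigQJacobi_eq_monicJacobi, Nat.add_sub_cancel]
  rw [show α / q * β = α * β / q by ring, show α * (β / q) = α * β / q by ring,
    show α / q * (β / q) = α * β / q / q by ring]
  obtain ⟨x, x', hx, hx', hi, hγx, hxα⟩ := h.exists_interlacing m
  have hm1 := h.monic (m + 1)
  have hm0 := h.monic m
  refine ⟨x, x', hx, hx', fun hα' => ?_, fun hβ' => ?_, fun hβ' => ?_, fun hn hα' hβ' =>
    h.exists_isZeroList_both hα' (hs hβ') (by lia)⟩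
  · obtain ⟨a, ha, e⟩ := exists_contiguous_left hq0 hq1 hα' hα1 hγ (m := m)
      (h.prod_lt_one (by lia))
    obtain ⟨y, hy, h1, h2⟩ := exists_isZeroList_add_neg hx hx' hm1 hm0 hi ha
    rw [← e] at hy
    exact ⟨y, hy, hγx, h1, fun j hj => ⟨h2 j hj, (hi j hj).2⟩⟩
  · obtain ⟨b, k, hb, hk, e, he⟩ := h.exists_contiguous_both (m := m) (by lia) (hs hβ')
    obtain ⟨z, hz, h1, h2, h3⟩ := exists_isZeroList_add_pos hx hx' hm1 hm0 hi hb hγx.le (by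
      rw [← e, he, mul_left_comm]
      exact mul_pos hk (h.sign_eval_left m))
    rw [← e] at hz
    exact ⟨z, hz, h1, hγx, h2, fun j hj => ⟨(hi j hj).1, h3 j hj⟩, hxα⟩
  · obtain ⟨a, ha, e⟩ := h.exists_contiguous_right (m := m) (by lia)
    -- Here `B = x 1`, where the sum reduces to `a * P_m`.
    obtain ⟨w, hw, -, h2, h3⟩ := exists_isZeroList_add_pos hx hx' hm1 hm0 hi ha le_rfl (by
      have h4 := mul_pos ha (sign_eval_lower hx hx' hm0 hi (j := 1) ⟨le_rfl, by lia⟩)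
      rw [eval_add, hx.eval_eq_zero ⟨le_rfl, by lia⟩, eval_mul, eval_C]
      refine lt_of_lt_of_eq h4 ?_
      ring)
    rw [← e] at hw
    exact ⟨w, hw, h2, fun j hj => ⟨(hi j hj).1, h3 j hj⟩, hxα⟩
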